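/- For a finite abstract simplicial complex $\Delta$ of dimension $n-1$ let $f_{i-1}(\Delta)$ be its number of faces with $i$ vertices (so $f_{-1}(\Delta)=1$) and let $h_i(\Delta)=\sum_{j=0}^{i}(-1)^{i-j}\binom{n-j}{i-j}f_{j-1}(\Delta)$, $0\le i\le n$, be the entries of its $h$-vector. The antiprism triangulation $\mathrm{sd}_{\mathcal A}(\Delta)$ is the clique complex of the graph whose nodes are the pointed faces $(F,v)$ of $\Delta$ ($F\in\Delta$, $v\in F$), where two distinct nodes $(F,v)$ and $(F',v')$ are adjacent if $F=F'$, or $F\subsetneq F'$ and $v'\in F'\setminus F$, or $F'\subsetneq F$ and $v\in F\setminus F'$. There are unique numbers $p_{\mathcal A}(n,k,j)$, for integers $n\ge 0$ and $0\le k,j\le n$, such that $$h_j(\mathrm{sd}_{\mathcal A}(\Delta))=\sum_{k=0}^{n}p_{\mathcal A}(n,k,j)\,h_k(\Delta)$$ for every $n \ge 0$, every $(n-1)$-dimensional finite simplicial complex $\Delta$ and every $j\in\{0,1,\dots,n\}$, where uniqueness is among arrays of integers; they are nonnegative integers. For all $n\in\mathbb N$ and $k,j\in\{0,1,\dots,n\}$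 they satisfy: (a) $p_{\mathcal A}(n,k,j)=p_{\mathcal A}(n,n-k,n-j)$; (b) $p_{\mathcal A}(n,k,0)\le p_{\mathcal A}(n,k,1)\le\cdots\le p_{\mathcal A}(n,k,\lfloor n/2\rfloor)$ and $p_{\mathcal A}(n,k,n)\le p_{\mathcal A}(n,k,n-1)\le\cdots\le p_{\mathcal A}(n,k,\lceil n/2\rceil)$. -/

import Mathlib

namespace Antiprism

/-- `faceCount Δ i` is `f_{i-1}(Δ)`, the number of faces with exactly `i` vertices. Mathlib's
abstract simplicial complexes record only the nonempty faces, so that the empty face (`i = 0`,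
`f_{-1}(Δ) = 1`) is added here. -/
noncomputable def faceCount {V : Type} (Δ : AbstractSimplicialComplex V) (i : ℕ) : ℕ :=
  {F : Finset V | (F = ∅ ∨ F ∈ Δ) ∧ F.card = i}.ncard

/-- `rank Δ` is `dim Δ + 1`, the largest number of vertices of a face (`0` if the vertex set
is empty, when the only face is the empty one). -/
noncomputable def rank {V : Type} (Δ : AbstractSimplicialComplex V) : ℕ :=
  sSup {m : ℕ | ∃ F ∈ Δ, F.card = m}

/-- The entry `h_i(Δ) = ∑_{j ≤ i} (-1)^(i-j) * C(n-j, i-j) * f_{j-1}(Δ)` of the `h`-vector of a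
complex `Δ` of dimension `n - 1`, for `0 ≤ i ≤ n`. -/
noncomputable def hVec {V : Type} (Δ : AbstractSimplicialComplex V) (i : ℕ) : ℤ :=
  ∑ j ∈ Finset.range (i + 1),
    (-1) ^ (i - j) * ((rank Δ - j).choose (i - j) : ℤ) * (faceCount Δ j : ℤ)

/-- The pointed faces `(F, v)` of `Δ`: a face `F` together with a vertex `v ∈ F`. -/
abbrev PointedFace {V : Type} (Δ : AbstractSimplicialComplex V) : Type :=
  {x : Finset V × V // x.1 ∈ Δ ∧ x.2 ∈ x.1}

/-- The graph on the pointed faces of `Δ` in which two distinct pointed faces `(F, v)` and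
`(F', v')` are adjacent if `F = F'`, or `F ⊂ F'` and `v' ∈ F' \ F`, or `F' ⊂ F` and
`v ∈ F \ F'`. -/
def antiprismGraph {V : Type} (Δ : AbstractSimplicialComplex V) :
    SimpleGraph (PointedFace Δ) where
  Adj x y := x ≠ y ∧
    (x.1.1 = y.1.1 ∨
      (x.1.1 ⊂ y.1.1 ∧ y.1.2 ∉ x.1.1) ∨
      (y.1.1 ⊂ x.1.1 ∧ x.1.2 ∉ y.1.1))
  symm := ⟨by
    rintro x y ⟨hne, h | h | h⟩
    · exact ⟨hne.symm, Or.inl h.symm⟩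
    · exact ⟨hne.symm, Or.inr (Or.inr h)⟩
    · exact ⟨hne.symm, Or.inr (Or.inl h)⟩⟩
  loopless := ⟨fun _ h => h.1 rfl⟩

/-- The clique complex of a graph: its faces are the finite sets of pairwise adjacent nodes. -/
def cliqueComplex {W : Type} (G : SimpleGraph W) : AbstractSimplicialComplex W where
  faces := {s | s.Nonempty ∧ G.IsClique (s : Set W)}
  isRelLowerSet_faces := by
    rintro s ⟨hs, hc⟩
    exact ⟨hs, fun t hts ht => ⟨ht, hc.subset (by exact_mod_cast hts)⟩⟩
  singleton_mem v := ⟨Finset.singleton_nonempty v, by simp⟩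

/-- The antiprism triangulation of `Δ`. -/
def antiprismTriangulation {V : Type} (Δ : AbstractSimplicialComplex V) :
    AbstractSimplicialComplex (PointedFace Δ) :=
  cliqueComplex (antiprismGraph Δ)

/-- The array `p` describes the transformation of `h`-vectors under antiprism triangulation:
for every finite simplicial complex `Δ` of dimension `n - 1` and every `0 ≤ j ≤ n`, the entry
`h_j` of the antiprism triangulation of `Δ` is `∑_{k=0}^{n} p n k j * h_k(Δ)`. -/
def IsAntiprismTransformation (p : ℕ → ℕ → ℕ → ℤ) : Prop :=
  ∀ (V : Type) [Finite V] (Δ : AbstractSimplicialComplex V) (n : ℕ), rank Δ = n →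
    ∀ j ≤ n, hVec (antiprismTriangulation Δ) j =
      ∑ k ∈ Finset.range (n + 1), p n k j * hVec Δ k

end Antiprism

/-! Let `B_m` be `basePoly m`, and let `umbral` replace `Y^m` by `B_m`. The coefficient array is
`p(n,k,j) = [X^j] umbral((Y+X)^k (Y+1)^(n-k))`, packaged as `transPoly k (n-k)`.

Transformation: a face of the triangulation with carrier `F` is a smaller one with carrier `G ⊂ F`
together with a nonempty subset of `F \ G`. The resulting recurrence for the local h-contributions
is solved by `transPoly |F| 0` (`transPoly_zero_right`, `sum_carried_X_pow`). Since `1 - X = (Y+1) -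
(Y+X)`, the factors `(1-X)^(n-|F|)` expand into the other `transPoly`, and regrouping turns face
numbers into h-entries.

Symmetry: `B_m` is symmetric with centre `m/2`, and reversing coefficients exchanges the roles of
`Y+X` and `Y+1`.

Unimodality: expand `transPoly k l` into terms `X^i B_(k+l-i-j)`, and expand the term with `i = j =
0` by the recurrence of `B`. Every other term then carries the factor `X^i + innerBinomial (i+j)`.
Moving the monomials strictly between `X^i` and `X^j` from the inner binomial to `X^i` makes both
pieces symmetric unimodal, with centres at most `1/2` away from `(i+j)/2`, so all the products peak
in the right place (`transPoly_mem_peaked`).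

Uniqueness: disjoint unions of two simplices supply enough h-vectors. -/

namespace Antiprism
open Polynomial

/-! ### Symmetric unimodal polynomials -/

/-- The truncated geometric series `1 + X + ⋯ + X ^ m`. -/
noncomputable def geomPoly (m : ℕ) : ℤ[X] := ∑ i ∈ Finset.range (m + 1), X ^ i

theorem geomPoly_mul (m : ℕ) : geomPoly m * (X - 1) = X ^ (m + 1) - 1 := geom_sum_mul _ _

theorem geomPoly_zero : geomPoly 0 = 1 := by simp [geomPoly]

theorem geomPoly_one : geomPoly 1 = 1 + X := by simp [geomPoly, Finset.sum_range_succ]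

theorem X_sub_one_ne_zero : (X - 1 : ℤ[X]) ≠ 0 := by
  simpa using X_sub_C_ne_zero (1 : ℤ)

/-- A Clebsch–Gordan step: peeling off the longest string is what makes symmetric unimodality
multiplicative. -/
theorem geomPoly_succ_mul_succ (a b : ℕ) :
    geomPoly (a + 1) * geomPoly (b + 1) = geomPoly (a + b + 2) + X * (geomPoly a * geomPoly b) := by
  apply mul_right_cancel₀ (mul_ne_zero X_sub_one_ne_zero X_sub_one_ne_zero)
  have h1 := geomPoly_mul (a + 1)
  have h2 := geomPoly_mul (b + 1)
  have h3 := geomPoly_mul (a + b + 2)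
  have h4 := geomPoly_mul a
  have h5 := geomPoly_mul b
  calc _ = (geomPoly (a + 1) * (X - 1)) * (geomPoly (b + 1) * (X - 1)) := by ring
    _ = (geomPoly (a + b + 2) * (X - 1)) * (X - 1) +
        X * ((geomPoly a * (X - 1)) * (geomPoly b * (X - 1))) := by
      rw [h1, h2, h3, h4, h5]; ring
    _ = _ := by ring

theorem one_add_X_mul_geomPoly (a : ℕ) :
    (1 + X) * geomPoly (a + 1) = geomPoly (a + 2) + X * geomPoly a := by
  have := geomPoly_succ_mul_succ 0 a
  rw [zero_add, geomPoly_one, geomPoly_zero, one_mul, zero_add] at this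
  exact this

theorem coeff_X_pow_mul_geomPoly (i m a : ℕ) :
    (X ^ i * geomPoly m).coeff a = if i ≤ a ∧ a ≤ i + m then 1 else 0 := by
  rw [coeff_X_pow_mul', geomPoly, finsetSum_coeff]
  simp only [coeff_X_pow, Finset.sum_ite_eq, Finset.mem_range]
  split_ifs <;> first | rfl | omega

/-- The polynomials with nonnegative coefficients that are symmetric and unimodal with centre of
symmetry `n / 2`: the nonnegative combinations of the `X ^ i + X ^ (i + 1) + ⋯ + X ^ (n - i)`. -/
noncomputable def symUnimodal (n : ℕ) : AddSubmonoid ℤ[X] :=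
  AddSubmonoid.closure {f | ∃ i m, 2 * i + m = n ∧ f = X ^ i * geomPoly m}

theorem X_pow_mul_geomPoly_mem {n i m : ℕ} (h : 2 * i + m = n) :
    X ^ i * geomPoly m ∈ symUnimodal n :=
  AddSubmonoid.subset_closure ⟨i, m, h, rfl⟩

theorem geomPoly_mem (n : ℕ) : geomPoly n ∈ symUnimodal n := by
  simpa using X_pow_mul_geomPoly_mem (n := n) (i := 0) (m := n) (by simp)

theorem X_pow_mul_mem {n : ℕ} (i : ℕ) {f : ℤ[X]} (hf : f ∈ symUnimodal n) :
    X ^ i * f ∈ symUnimodal (2 * i + n) := by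
  induction hf using AddSubmonoid.closure_induction with
  | mem f hf =>
    obtain ⟨a, m, h, rfl⟩ := hf
    rw [← mul_assoc, ← pow_add]
    exact X_pow_mul_geomPoly_mem (by omega)
  | zero => rw [mul_zero]; exact zero_mem _
  | add f g _ _ hf hg => rw [mul_add]; exact add_mem hf hg

theorem geomPoly_mul_geomPoly_mem (a b : ℕ) :
    geomPoly a * geomPoly b ∈ symUnimodal (a + b) := by
  induction a generalizing b with
  | zero => rw [geomPoly_zero, one_mul, zero_add]; exact geomPoly_mem b
  | succ a ih =>
    cases b with
    | zero => rw [geomPoly_zero, mul_one]; exact geomPoly_mem _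
    | succ b =>
      rw [geomPoly_succ_mul_succ, show a + 1 + (b + 1) = a + b + 2 by ring]
      refine add_mem (geomPoly_mem _) ?_
      have := X_pow_mul_mem 1 (ih b)
      rwa [pow_one, show 2 * 1 + (a + b) = a + b + 2 by ring] at this

theorem mul_mem_symUnimodal {m n : ℕ} {f g : ℤ[X]} (hf : f ∈ symUnimodal m)
    (hg : g ∈ symUnimodal n) : f * g ∈ symUnimodal (m + n) := by
  induction hf using AddSubmonoid.closure_induction with
  | mem f hf =>
    obtain ⟨i, a, h, rfl⟩ := hf
    induction hg using AddSubmonoid.closure_induction with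
    | mem g hg =>
      obtain ⟨j, b, h', rfl⟩ := hg
      have := X_pow_mul_mem (i + j) (geomPoly_mul_geomPoly_mem a b)
      rw [show 2 * (i + j) + (a + b) = m + n by omega] at this
      convert this using 1
      ring
    | zero => rw [mul_zero]; exact zero_mem _
    | add f g _ _ hf hg => rw [mul_add]; exact add_mem hf hg
  | zero => rw [zero_mul]; exact zero_mem _
  | add f g _ _ hf hg => rw [add_mul]; exact add_mem hf hg

theorem natCast_mul_mem {n : ℕ} (c : ℕ) {f : ℤ[X]} (hf : f ∈ symUnimodal n) :
    (c : ℤ[X]) * f ∈ symUnimodal n := by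
  rw [← nsmul_eq_mul]; exact nsmul_mem hf c

theorem one_add_X_mul_mem {n : ℕ} {f : ℤ[X]} (hf : f ∈ symUnimodal n) :
    (1 + X) * f ∈ symUnimodal (n + 1) := by
  rw [add_comm n, ← geomPoly_one]
  exact mul_mem_symUnimodal (geomPoly_mem 1) hf

theorem binomial_sub_geomPoly_mem (m : ℕ) :
    (1 + X) ^ m - geomPoly m ∈ symUnimodal m := by
  induction m with
  | zero => rw [pow_zero, geomPoly_zero, sub_self]; exact zero_mem _
  | succ m ih =>
    have h := one_add_X_mul_mem ih
    cases m with
    | zero => rw [zero_add, pow_one, geomPoly_one, sub_self]; exact zero_mem _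
    | succ m =>
      have h2 : X ^ 1 * geomPoly m ∈ symUnimodal (m + 1 + 1) := X_pow_mul_geomPoly_mem (by ring)
      convert add_mem h h2 using 1
      rw [mul_sub, one_add_X_mul_geomPoly]
      ring

/-- Pascal's rule, lowering `c` while raising `m`: multiplying the case `(c, m + 1)` by `1 + X`
subtracts two strings too many, and these are added back as `h2` and `h3`. -/
theorem binomial_sub_geomPoly_sub_mem (m c : ℕ) :
    (1 + X) ^ (2 * (c + 1) + m) - geomPoly (2 * (c + 1) + m) - X ^ (c + 1) * geomPoly m
      ∈ symUnimodal (2 * (c + 1) + m) := by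
  induction c generalizing m with
  | zero =>
    have h := one_add_X_mul_mem (binomial_sub_geomPoly_mem (m + 1))
    rw [show 2 * (0 + 1) + m = m + 1 + 1 by ring]
    convert h using 1
    rw [mul_sub, one_add_X_mul_geomPoly]
    ring
  | succ c ih =>
    have h := one_add_X_mul_mem (ih (m + 1))
    rw [show 2 * (c + 1) + (m + 1) + 1 = 2 * (c + 1 + 1) + m by ring] at h
    have h2 : X ^ 1 * geomPoly (2 * (c + 1) + m) ∈ symUnimodal (2 * (c + 1 + 1) + m) :=
      X_pow_mul_geomPoly_mem (by ring)
    have h3 : X ^ (c + 1) * geomPoly (m + 2) ∈ symUnimodal (2 * (c + 1 + 1) + m) :=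
      X_pow_mul_geomPoly_mem (by ring)
    convert add_mem (add_mem h h2) h3 using 1
    have e1 := one_add_X_mul_geomPoly (2 * (c + 1) + m)
    have e2 := one_add_X_mul_geomPoly m
    rw [show 2 * (c + 1) + (m + 1) = 2 * (c + 1) + m + 1 by ring,
      show 2 * (c + 1 + 1) + m = 2 * (c + 1) + m + 1 + 1 by ring]
    linear_combination e1 + X ^ (c + 1) * e2

/-! ### Inner binomials and the gap between two monomials -/

/-- The inner part `∑_{0 < i < m} C(m, i) X ^ i` of the binomial expansion of `(1 + X) ^ m`. -/
noncomputable def innerBinomial (m : ℕ) : ℤ[X] := (X + 1) ^ m - X ^ m - 1 + 0 ^ m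

theorem innerBinomial_zero : innerBinomial 0 = 0 := by simp [innerBinomial]

theorem innerBinomial_one : innerBinomial 1 = 0 := by simp [innerBinomial]

theorem geomPoly_add_two (m : ℕ) : geomPoly (m + 2) = 1 + X * geomPoly m + X ^ (m + 2) := by
  rw [geomPoly, Finset.sum_range_succ, Finset.sum_range_succ', geomPoly, Finset.mul_sum]
  simp only [pow_succ']
  ring

theorem innerBinomial_add_two (m : ℕ) :
    innerBinomial (m + 2) = (1 + X) ^ (m + 2) - geomPoly (m + 2) + X * geomPoly m := by
  rw [innerBinomial, geomPoly_add_two, zero_pow (by omega)]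
  ring

theorem innerBinomial_mem (m : ℕ) : innerBinomial m ∈ symUnimodal m := by
  match m with
  | 0 => rw [innerBinomial_zero]; exact zero_mem _
  | 1 => rw [innerBinomial_one]; exact zero_mem _
  | m + 2 =>
    rw [innerBinomial_add_two]
    refine add_mem (binomial_sub_geomPoly_mem _) ?_
    simpa using X_pow_mul_geomPoly_mem (n := m + 2) (i := 1) (m := m) (by ring)

theorem innerBinomial_sub_mem (m c : ℕ) :
    innerBinomial (2 * (c + 1) + m) - X ^ (c + 1) * geomPoly m
      ∈ symUnimodal (2 * (c + 1) + m) := by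
  have h := add_mem (binomial_sub_geomPoly_sub_mem m c)
    (X_pow_mul_geomPoly_mem (n := 2 * (c + 1) + m) (i := 1) (m := 2 * c + m) (by ring))
  convert h using 1
  have := innerBinomial_add_two (2 * c + m)
  rw [show 2 * c + m + 2 = 2 * (c + 1) + m by ring] at this
  rw [this]
  ring

/-- The sum of the `X ^ a` with `min i j < a < max i j`. -/
noncomputable def betweenPoly (i j : ℕ) : ℤ[X] :=
  if i + 2 ≤ j then X ^ (i + 1) * geomPoly (j - i - 2)
  else if j + 2 ≤ i then X ^ (j + 1) * geomPoly (i - j - 2) else 0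

/-- The gap is a centred string that avoids the end degrees, so the inner binomial can spare it. -/
theorem innerBinomial_sub_betweenPoly_mem (i j : ℕ) :
    innerBinomial (i + j) - betweenPoly i j ∈ symUnimodal (i + j) := by
  unfold betweenPoly
  split_ifs with h1 h2
  · have := innerBinomial_sub_mem (j - i - 2) i
    rwa [show 2 * (i + 1) + (j - i - 2) = i + j by omega] at this
  · have := innerBinomial_sub_mem (i - j - 2) j
    rwa [show 2 * (j + 1) + (i - j - 2) = i + j by omega] at this
  · rw [sub_zero]; exact innerBinomial_mem _

theorem geomPoly_succ (m : ℕ) : geomPoly (m + 1) = 1 + X * geomPoly m := by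
  rw [geomPoly, Finset.sum_range_succ', geomPoly, Finset.mul_sum]
  simp only [pow_succ']
  ring

theorem geomPoly_succ' (m : ℕ) : geomPoly (m + 1) = geomPoly m + X ^ (m + 1) := by
  rw [geomPoly, Finset.sum_range_succ, geomPoly]

/-- The gap completes `X^i` to a string with centre `(i + j - 1) / 2`; in the opposite case below
the centre is `(i + j + 1) / 2`. -/
theorem X_pow_add_betweenPoly_of_lt {i j : ℕ} (h : i < j) :
    X ^ i + betweenPoly i j = X ^ i * geomPoly (j - i - 1) := by
  obtain ⟨d, rfl⟩ := Nat.exists_eq_add_of_lt h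
  unfold betweenPoly
  cases d with
  | zero => rw [if_neg (by omega), if_neg (by omega)]; simp [geomPoly_zero]
  | succ d =>
    rw [if_pos (by omega), show i + (d + 1) + 1 - i - 2 = d by omega,
      show i + (d + 1) + 1 - i - 1 = d + 1 by omega, geomPoly_succ]
    ring

theorem X_pow_add_betweenPoly_of_gt {i j : ℕ} (h : j < i) :
    X ^ i + betweenPoly i j = X ^ (j + 1) * geomPoly (i - j - 1) := by
  obtain ⟨d, rfl⟩ := Nat.exists_eq_add_of_lt h
  unfold betweenPoly
  cases d with
  | zero => rw [if_neg (by omega), if_neg (by omega)]; simp [geomPoly_zero]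
  | succ d =>
    rw [if_neg (by omega), if_pos (by omega), show j + (d + 1) + 1 - j - 2 = d by omega,
      show j + (d + 1) + 1 - j - 1 = d + 1 by omega, geomPoly_succ']
    ring

theorem betweenPoly_self (i : ℕ) : betweenPoly i i = 0 := by
  simp [betweenPoly]

/-! ### Peaks at the middle, without symmetry -/

/-- The polynomials with nonnegative coefficients that increase up to degree `⌊n / 2⌋` and
decrease from degree `⌈n / 2⌉` on. -/
def peaked (n : ℕ) : AddSubmonoid ℤ[X] where
  carrier := {f | (∀ a, 0 ≤ f.coeff a) ∧ (∀ a, a + 1 ≤ n / 2 → f.coeff a ≤ f.coeff (a + 1)) ∧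
    ∀ a, (n + 1) / 2 ≤ a → f.coeff (a + 1) ≤ f.coeff a}
  zero_mem' := by simp
  add_mem' := by
    rintro f g ⟨h1, h2, h3⟩ ⟨h1', h2', h3'⟩
    simp only [Set.mem_ofPred_eq, coeff_add]
    exact ⟨fun a => add_nonneg (h1 a) (h1' a), fun a ha => add_le_add (h2 a ha) (h2' a ha),
      fun a ha => add_le_add (h3 a ha) (h3' a ha)⟩

/-- The peak conditions tolerate a shift of the centre by `1/2` in either direction, which is the
slack needed for `transPoly`. -/
theorem symUnimodal_le_peaked {m n : ℕ} (h1 : m ≤ n + 1) (h2 : n ≤ m + 1) :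
    symUnimodal m ≤ peaked n := by
  refine (AddSubmonoid.closure_le).2 ?_
  rintro _ ⟨i, d, h, rfl⟩
  refine ⟨fun a => ?_, fun a ha => ?_, fun a ha => ?_⟩
  · rw [coeff_X_pow_mul_geomPoly]; split_ifs <;> simp
  all_goals
    rw [coeff_X_pow_mul_geomPoly, coeff_X_pow_mul_geomPoly]
    split_ifs <;> omega

/-! ### Base polynomials and umbral calculus -/

/-- The polynomials with exponential generating function `1 / (1 - (e ^ (X s) - 1) (e ^ s - 1))`. -/
noncomputable def basePoly : ℕ → ℤ[X]
  | 0 => 1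
  | n + 1 => ∑ m : Fin (n + 1), ((n + 1).choose m : ℤ[X]) * innerBinomial (n + 1 - m) * basePoly m

theorem basePoly_eq_sum {n : ℕ} (hn : n ≠ 0) :
    basePoly n = ∑ m ∈ Finset.range (n + 1),
      (n.choose m : ℤ[X]) * innerBinomial (n - m) * basePoly m := by
  obtain ⟨n, rfl⟩ := Nat.exists_eq_succ_of_ne_zero hn
  rw [Finset.sum_range_succ, Nat.sub_self, innerBinomial_zero, mul_zero, zero_mul, add_zero,
    Finset.sum_range, Nat.succ_eq_add_one, basePoly]

theorem basePoly_mem (n : ℕ) : basePoly n ∈ symUnimodal n := by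
  induction n using Nat.strong_induction_on with
  | _ n ih =>
    cases n with
    | zero => rw [basePoly, ← geomPoly_zero]; exact geomPoly_mem 0
    | succ n =>
      rw [basePoly]
      refine sum_mem fun m _ => ?_
      have := mul_mem_symUnimodal (natCast_mul_mem ((n + 1).choose m)
        (innerBinomial_mem (n + 1 - m))) (ih m m.2)
      rwa [show n + 1 - (m : ℕ) + m = n + 1 by omega] at this

/-- The linear map sending `Y ^ m` to `basePoly m`. -/
noncomputable def umbral : ℤ[X][X] →ₗ[ℤ[X]] ℤ[X] :=
  Polynomial.lsum fun m => LinearMap.mulRight ℤ[X] (basePoly m)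

theorem umbral_C_mul (a : ℤ[X]) (f : ℤ[X][X]) : umbral (C a * f) = a * umbral f := by
  rw [← smul_eq_C_mul, map_smul, smul_eq_mul]

theorem umbral_X_pow (m : ℕ) : umbral (X ^ m) = basePoly m := by
  simp [umbral, lsum_apply, ← monomial_one_right_eq_X_pow]

theorem umbral_C_mul_X_pow (a : ℤ[X]) (m : ℕ) : umbral (C a * X ^ m) = a * basePoly m := by
  rw [umbral_C_mul, umbral_X_pow]

/-- The polynomial `∑ j, p(k + l, k, j) X ^ j`. -/
noncomputable def transPoly (k l : ℕ) : ℤ[X] := umbral ((X + C X) ^ k * (X + C 1) ^ l)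

theorem add_pow_mul_add_pow {A : Type*} [CommRing A] (y a b : A) (k l : ℕ) :
    (y + a) ^ k * (y + b) ^ l = ∑ i ∈ Finset.range (k + 1), ∑ j ∈ Finset.range (l + 1),
      (k.choose i : A) * (l.choose j : A) * (a ^ i * b ^ j) * y ^ (k + l - (i + j)) := by
  rw [add_comm y a, add_comm y b, add_pow, add_pow, Finset.sum_mul_sum]
  refine Finset.sum_congr rfl fun i hi => Finset.sum_congr rfl fun j hj => ?_
  rw [Finset.mem_range] at hi hj
  rw [show k + l - (i + j) = (k - i) + (l - j) by omega]
  ring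

theorem umbral_add_pow_mul_add_pow (a b : ℤ[X]) (k l : ℕ) :
    umbral ((X + C a) ^ k * (X + C b) ^ l) =
      ∑ i ∈ Finset.range (k + 1), ∑ j ∈ Finset.range (l + 1),
        (k.choose i : ℤ[X]) * (l.choose j : ℤ[X]) * (a ^ i * b ^ j) *
          basePoly (k + l - (i + j)) := by
  rw [add_pow_mul_add_pow, map_sum]
  refine Finset.sum_congr rfl fun i _ => ?_
  rw [map_sum]
  refine Finset.sum_congr rfl fun j _ => ?_
  rw [← umbral_C_mul_X_pow]
  simp only [map_mul, map_pow, map_natCast]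

theorem transPoly_eq_sum (k l : ℕ) :
    transPoly k l = ∑ i ∈ Finset.range (k + 1), ∑ j ∈ Finset.range (l + 1),
      (k.choose i : ℤ[X]) * (l.choose j : ℤ[X]) * (X ^ i * basePoly (k + l - (i + j))) := by
  rw [transPoly, umbral_add_pow_mul_add_pow]
  simp only [one_pow, mul_one, mul_assoc]

theorem umbral_X_add_C_pow (k l : ℕ) (a : ℤ[X]) :
    umbral ((X + C a) ^ (k + l)) = ∑ i ∈ Finset.range (k + 1), ∑ j ∈ Finset.range (l + 1),
      (k.choose i : ℤ[X]) * (l.choose j : ℤ[X]) * (a ^ (i + j) * basePoly (k + l - (i + j))) := by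
  rw [pow_add, umbral_add_pow_mul_add_pow]
  simp only [pow_add, mul_assoc]

theorem umbral_add_C_pow (f : ℤ[X][X]) (a : ℤ[X]) (n : ℕ) :
    umbral ((f + C a) ^ n) = ∑ m ∈ Finset.range (n + 1),
      (n.choose m : ℤ[X]) * a ^ (n - m) * umbral (f ^ m) := by
  rw [add_pow, map_sum]
  refine Finset.sum_congr rfl fun m _ => ?_
  rw [← umbral_C_mul, mul_comm, ← mul_assoc, mul_right_comm]
  simp only [map_mul, map_pow, map_natCast, mul_comm]

/-- The recurrence of `basePoly` in umbral form: the four shifts are the four terms of `(e^(Xs) -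
1)(e^s - 1)`. -/
theorem umbral_functional_equation {n : ℕ} (hn : n ≠ 0) :
    umbral ((X + C (X + 1)) ^ n) - umbral ((X + C X) ^ n) - umbral ((X + C 1) ^ n)
      + umbral ((X + C 0) ^ n) = basePoly n := by
  rw [basePoly_eq_sum hn]
  simp only [umbral_add_C_pow, umbral_X_pow, ← Finset.sum_sub_distrib, ← Finset.sum_add_distrib]
  refine Finset.sum_congr rfl fun m _ => ?_
  rw [innerBinomial]
  ring

theorem basePoly_add_eq_sum {k l : ℕ} (h : k + l ≠ 0) :
    basePoly (k + l) = ∑ i ∈ Finset.range (k + 1), ∑ j ∈ Finset.range (l + 1),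
      (k.choose i : ℤ[X]) * (l.choose j : ℤ[X]) *
        (innerBinomial (i + j) * basePoly (k + l - (i + j))) := by
  rw [← umbral_functional_equation h]
  simp only [umbral_X_add_C_pow, ← Finset.sum_sub_distrib, ← Finset.sum_add_distrib]
  refine Finset.sum_congr rfl fun i _ => Finset.sum_congr rfl fun j _ => ?_
  rw [innerBinomial]
  ring

theorem transPoly_zero_zero : transPoly 0 0 = 1 := by
  simp [transPoly_eq_sum, basePoly]

/-- This is the functional equation re-expanded in powers of `Y + X`; it matches the recurrence
satisfied by the faces with a given carrier. -/
theorem transPoly_zero_right {n : ℕ} (hn : n ≠ 0) :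
    transPoly n 0 = ∑ m ∈ Finset.range (n + 1),
      (n.choose m : ℤ[X]) * ((1 - (1 - X) ^ (n - m)) * transPoly m 0) := by
  have h := umbral_functional_equation hn
  rw [C_0, add_zero, umbral_X_pow] at h
  have h3 (m : ℕ) : transPoly m 0 = umbral ((X + C X) ^ m) := by rw [transPoly, pow_zero, mul_one]
  have h1 (a : ℤ[X]) : umbral ((X + C (X + a)) ^ n) = ∑ m ∈ Finset.range (n + 1),
      (n.choose m : ℤ[X]) * a ^ (n - m) * transPoly m 0 := by
    rw [C_add, ← add_assoc, umbral_add_C_pow]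
    simp only [h3]
  -- The shift by `1` is written as `X + (1 - X)`, so that it too is expanded around `Y + X`.
  have h2 := h1 (1 - X)
  rw [add_sub_cancel] at h2
  rw [h1 1, h2, ← h3, sub_right_comm, ← Finset.sum_sub_distrib] at h
  rw [eq_comm, ← sub_eq_zero, ← sub_eq_zero.2 h]
  have : ∀ m, (n.choose m : ℤ[X]) * ((1 - (1 - X) ^ (n - m)) * transPoly m 0) =
      (n.choose m : ℤ[X]) * 1 ^ (n - m) * transPoly m 0 -
        (n.choose m : ℤ[X]) * (1 - X) ^ (n - m) * transPoly m 0 := fun m => by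
    rw [one_pow]; ring
  simp only [this]
  ring

/-! ### Unimodality and symmetry of the coefficients -/

theorem natCast_mul_mem_peaked {n : ℕ} (c : ℕ) {f : ℤ[X]} (hf : f ∈ peaked n) :
    (c : ℤ[X]) * f ∈ peaked n := by
  rw [← nsmul_eq_mul]; exact nsmul_mem hf c

theorem X_pow_add_betweenPoly_mul_basePoly_mem (i j m : ℕ) :
    (X ^ i + betweenPoly i j) * basePoly m ∈ peaked (i + j + m) := by
  rcases lt_trichotomy i j with h | rfl | h
  · rw [X_pow_add_betweenPoly_of_lt h]
    exact symUnimodal_le_peaked (m := i + j - 1 + m) (by omega) (by omega)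
      (mul_mem_symUnimodal (X_pow_mul_geomPoly_mem (by omega)) (basePoly_mem m))
  · rw [betweenPoly_self, add_zero]
    have := X_pow_mul_mem i (basePoly_mem m)
    exact symUnimodal_le_peaked (by omega) (by omega) this
  · rw [X_pow_add_betweenPoly_of_gt h]
    exact symUnimodal_le_peaked (m := i + j + 1 + m) (by omega) (by omega)
      (mul_mem_symUnimodal (X_pow_mul_geomPoly_mem (by omega)) (basePoly_mem m))

theorem transPoly_mem_peaked (k l : ℕ) : transPoly k l ∈ peaked (k + l) := by
  rcases eq_or_ne (k + l) 0 with h0 | h0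
  · obtain ⟨rfl, rfl⟩ : k = 0 ∧ l = 0 := by omega
    rw [transPoly_zero_zero, ← geomPoly_zero]
    exact symUnimodal_le_peaked le_self_add le_self_add (geomPoly_mem 0)
  -- The term `i = j = 0` is dropped on the right: its `basePoly (k + l)` has been spread over the
  -- other terms as the inner binomials.
  have key : transPoly k l = ∑ i ∈ Finset.range (k + 1), ∑ j ∈ Finset.range (l + 1),
      (k.choose i : ℤ[X]) * (l.choose j : ℤ[X]) *
        ((if i + j = 0 then 0 else (X ^ i + betweenPoly i j) * basePoly (k + l - (i + j))) +
          (innerBinomial (i + j) - betweenPoly i j) * basePoly (k + l - (i + j))) := by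
    have h1 : ∑ i ∈ Finset.range (k + 1), ∑ j ∈ Finset.range (l + 1),
        (if i + j = 0 then basePoly (k + l) else 0) = basePoly (k + l) := by
      rw [Finset.sum_eq_single 0 _ (by simp), Finset.sum_eq_single 0 _ (by simp)]
      · simp
      · intro j _ hj; simp [hj]
      · intro i _ hi; exact Finset.sum_eq_zero fun j _ => by simp [hi]
    replace h1 := h1.trans (basePoly_add_eq_sum h0)
    -- Adding `basePoly (k + l)` to both sides, disguised as a double sum, allows a termwise
    -- comparison without subtraction.
    rw [transPoly_eq_sum, ← add_right_inj (∑ i ∈ Finset.range (k + 1),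
      ∑ j ∈ Finset.range (l + 1), if i + j = 0 then basePoly (k + l) else 0)]
    nth_rewrite 1 [h1]
    simp only [← Finset.sum_add_distrib]
    refine Finset.sum_congr rfl fun i _ => Finset.sum_congr rfl fun j _ => ?_
    split_ifs with h
    · obtain ⟨rfl, rfl⟩ : i = 0 ∧ j = 0 := by omega
      simp [betweenPoly_self]
      ring
    · ring
  rw [key]
  refine sum_mem fun i hi => sum_mem fun j hj => ?_
  rw [Finset.mem_range] at hi hj
  rw [← Nat.cast_mul]
  have hs : i + j + (k + l - (i + j)) = k + l := by omega
  refine natCast_mul_mem_peaked _ (add_mem ?_ ?_)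
  · split_ifs
    · exact zero_mem _
    · have := X_pow_add_betweenPoly_mul_basePoly_mem i j (k + l - (i + j))
      rwa [hs] at this
  · have := mul_mem_symUnimodal (innerBinomial_sub_betweenPoly_mem i j)
      (basePoly_mem (k + l - (i + j)))
    rw [hs] at this
    exact symUnimodal_le_peaked (by omega) (by omega) this

theorem coeff_symm_of_mem {n : ℕ} {f : ℤ[X]} (hf : f ∈ symUnimodal n) :
    (∀ a ≤ n, f.coeff (n - a) = f.coeff a) ∧ ∀ a, n < a → f.coeff a = 0 := by
  induction hf using AddSubmonoid.closure_induction with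
  | mem f hf =>
    obtain ⟨i, m, h, rfl⟩ := hf
    refine ⟨fun a ha => ?_, fun a ha => ?_⟩
    · rw [coeff_X_pow_mul_geomPoly, coeff_X_pow_mul_geomPoly]
      exact if_congr (by omega) rfl rfl
    · rw [coeff_X_pow_mul_geomPoly, if_neg (by omega)]
  | zero => simp
  | add f g _ _ hf hg =>
    refine ⟨fun a ha => ?_, fun a ha => ?_⟩
    · rw [coeff_add, coeff_add, hf.1 a ha, hg.1 a ha]
    · rw [coeff_add, hf.2 a ha, hg.2 a ha, add_zero]

theorem coeff_transPoly_symm {k l a : ℕ} (ha : a ≤ k + l) :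
    (transPoly k l).coeff a = (transPoly l k).coeff (k + l - a) := by
  rw [transPoly_eq_sum, transPoly_eq_sum, Finset.sum_comm]
  simp only [finsetSum_coeff]
  refine Finset.sum_congr rfl fun j hj => Finset.sum_congr rfl fun i hi => ?_
  rw [Finset.mem_range] at hi hj
  rw [mul_comm (l.choose j : ℤ[X]), ← Nat.cast_mul, ← C_eq_natCast, coeff_C_mul, coeff_C_mul,
    coeff_X_pow_mul', coeff_X_pow_mul', show l + k - (j + i) = k + l - (i + j) by omega]
  congr 1
  obtain ⟨h1, h2⟩ := coeff_symm_of_mem (basePoly_mem (k + l - (i + j)))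
  split_ifs with h3 h4 h4
  · rw [← h1 (a - i) (by omega)]
    congr 1
    omega
  · exact h2 _ (by omega)
  · exact (h2 _ (by omega)).symm
  · rfl

/-- The binomial theorem for `1 - X = (Y + 1) - (Y + X)` under `umbral`. -/
theorem sum_choose_mul_transPoly (a m l : ℕ) :
    ∑ r ∈ Finset.range (a + 1), (-1) ^ r * (a.choose r : ℤ[X]) * transPoly (m + r) (l + (a - r))
      = (1 - X) ^ a * transPoly m l := by
  have h := congrArg (fun f => umbral ((X + C X) ^ m * (X + C 1) ^ l * f))
    (add_pow (-(X + C (X : ℤ[X]))) (X + C 1) a)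
  have e : -(X + C (X : ℤ[X])) + (X + C 1) = C (1 - X : ℤ[X]) := by rw [C_sub]; ring
  rw [e, ← C_pow] at h
  simp only [mul_comm _ (C ((1 - X : ℤ[X]) ^ a)), umbral_C_mul] at h
  rw [transPoly, h, Finset.mul_sum, map_sum]
  refine Finset.sum_congr rfl fun r _ => ?_
  rw [transPoly, ← umbral_C_mul]
  refine congrArg umbral ?_
  simp only [map_mul, map_pow, map_natCast, map_neg, map_one]
  generalize X + C (X : ℤ[X]) = u
  rw [neg_pow u, pow_add, pow_add]
  ring

/-! ### Faces and h-polynomials of finite complexes -/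

open scoped Classical in
/-- The faces of a finite complex, including the empty one. -/
noncomputable def faceFinset {W : Type} [Fintype W] (K : AbstractSimplicialComplex W) :
    Finset (Finset W) :=
  {F | F = ∅ ∨ F ∈ K}

theorem mem_faceFinset {W : Type} [Fintype W] {K : AbstractSimplicialComplex W} {F : Finset W} :
    F ∈ faceFinset K ↔ F = ∅ ∨ F ∈ K := by
  classical simp [faceFinset]

theorem faceCount_eq_card {W : Type} [Fintype W] (K : AbstractSimplicialComplex W) (i : ℕ) :
    faceCount K i = ((faceFinset K).filter fun F => F.card = i).card := by
  rw [faceCount, ← Set.ncard_coe_finset]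
  congr 1
  ext F
  simp [mem_faceFinset]

theorem card_le_rank {W : Type} [Finite W] {K : AbstractSimplicialComplex W} {F : Finset W}
    (hF : F ∈ K) : F.card ≤ rank K := by
  have := Fintype.ofFinite W
  refine le_csSup ⟨Fintype.card W, ?_⟩ ⟨F, hF, rfl⟩
  rintro _ ⟨G, -, rfl⟩
  exact G.card_le_univ

theorem rank_eq_of_forall_le {W : Type} [Finite W] {K : AbstractSimplicialComplex W} {n : ℕ}
    (h1 : ∀ F ∈ K, F.card ≤ n) (h2 : n ≠ 0 → ∃ F ∈ K, F.card = n) : rank K = n := by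
  apply le_antisymm
  · exact csSup_le' (by rintro _ ⟨F, hF, rfl⟩; exact h1 F hF)
  · rcases eq_or_ne n 0 with rfl | hn
    · exact Nat.zero_le _
    · obtain ⟨F, hF, rfl⟩ := h2 hn
      exact card_le_rank hF

theorem exists_card_eq_rank {W : Type} [Finite W] {K : AbstractSimplicialComplex W}
    (h : rank K ≠ 0) : ∃ F ∈ K, F.card = rank K := by
  have := Fintype.ofFinite W
  have hne : {m : ℕ | ∃ F ∈ K, F.card = m}.Nonempty := by
    by_contra hne
    rw [Set.not_nonempty_iff_eq_empty] at hne
    exact h (by rw [rank, hne, csSup_empty]; rfl)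
  refine Nat.sSup_mem hne ⟨Fintype.card W, ?_⟩
  rintro _ ⟨G, -, rfl⟩
  exact G.card_le_univ

theorem sum_faceFinset {W : Type} [Fintype W] (K : AbstractSimplicialComplex W)
    (g : ℕ → ℤ[X]) : ∑ F ∈ faceFinset K, g F.card =
      ∑ i ∈ Finset.range (rank K + 1), (faceCount K i : ℤ[X]) * g i := by
  rw [← Finset.sum_fiberwise_of_maps_to (t := Finset.range (rank K + 1)) (g := Finset.card)]
  · refine Finset.sum_congr rfl fun i _ => ?_
    rw [faceCount_eq_card, ← nsmul_eq_mul, ← Finset.sum_const]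
    refine Finset.sum_congr rfl fun F hF => ?_
    rw [(Finset.mem_filter.1 hF).2]
  · intro F hF
    rw [Finset.mem_range, Nat.lt_succ_iff]
    rcases mem_faceFinset.1 hF with rfl | hF
    · simp
    · exact card_le_rank hF

theorem coeff_one_sub_X_pow (a b : ℕ) :
    ((1 - X : ℤ[X]) ^ a).coeff b = (-1) ^ b * (a.choose b : ℤ) := by
  have : (1 - X : ℤ[X]) ^ a = ((1 + X) ^ a).comp (C (-1) * X) := by simp [sub_eq_add_neg]
  rw [this, comp_C_mul_X_coeff, coeff_one_add_X_pow, mul_comm]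

theorem hVec_eq_coeff {W : Type} [Fintype W] (K : AbstractSimplicialComplex W) {j : ℕ}
    (hj : j ≤ rank K) :
    hVec K j = (∑ F ∈ faceFinset K, X ^ F.card * (1 - X : ℤ[X]) ^ (rank K - F.card)).coeff j := by
  rw [sum_faceFinset K fun i => X ^ i * (1 - X : ℤ[X]) ^ (rank K - i), finsetSum_coeff, hVec]
  rw [← Finset.sum_subset (Finset.range_mono (Nat.succ_le_succ hj))]
  · refine Finset.sum_congr rfl fun i hi => ?_
    rw [← C_eq_natCast, coeff_C_mul, coeff_X_pow_mul',
      if_pos (Nat.lt_succ_iff.1 (Finset.mem_range.1 hi)), coeff_one_sub_X_pow]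
    ring
  · intro i _ hi
    rw [Finset.mem_range] at hi
    rw [← C_eq_natCast, coeff_C_mul, coeff_X_pow_mul', if_neg (by omega), mul_zero]

/-! ### Faces of the triangulation, sorted by carrier -/

/-- The faces of the antiprism triangulation of a simplex, as sets of pairs. -/
def IsPointedFlag {V : Type} (c : Finset (Finset V × V)) : Prop :=
  (∀ a ∈ c, a.2 ∈ a.1) ∧ ∀ a ∈ c, ∀ b ∈ c,
    a.1 = b.1 ∨ (a.1 ⊂ b.1 ∧ b.2 ∉ a.1) ∨ (b.1 ⊂ a.1 ∧ a.2 ∉ b.1)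

theorem isClique_antiprismGraph_iff {V : Type} {Δ : AbstractSimplicialComplex V}
    (s : Finset (PointedFace Δ)) :
    (antiprismGraph Δ).IsClique (s : Set (PointedFace Δ)) ↔
      IsPointedFlag (s.map (Function.Embedding.subtype _)) := by
  constructor
  · intro h
    refine ⟨?_, ?_⟩
    · intro a ha
      obtain ⟨x, -, rfl⟩ := Finset.mem_map.1 ha
      exact x.2.2
    · intro a ha b hb
      obtain ⟨x, hx, rfl⟩ := Finset.mem_map.1 ha
      obtain ⟨y, hy, rfl⟩ := Finset.mem_map.1 hb
      rcases eq_or_ne x y with rfl | hne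
      · exact Or.inl rfl
      · exact (h hx hy hne).2
  · intro h x hx y hy hne
    exact ⟨hne, h.2 x (Finset.mem_map_of_mem _ hx) y (Finset.mem_map_of_mem _ hy)⟩

theorem IsPointedFlag.mono {V : Type} {c d : Finset (Finset V × V)} (hc : IsPointedFlag c)
    (h : d ⊆ c) : IsPointedFlag d :=
  ⟨fun a ha => hc.1 a (h ha), fun a ha b hb => hc.2 a (h ha) b (h hb)⟩

section

variable {V : Type} [DecidableEq V]

theorem IsPointedFlag.exists_fst_eq_sup {c : Finset (Finset V × V)} (hc : IsPointedFlag c)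
    (hne : c.Nonempty) : ∃ a ∈ c, a.1 = c.sup Prod.fst := by
  obtain ⟨a, ha, hmax⟩ := c.exists_max_image (fun a => a.1.card) hne
  refine ⟨a, ha, le_antisymm (Finset.le_sup (f := Prod.fst) ha) (Finset.sup_le fun b hb => ?_)⟩
  rcases hc.2 a ha b hb with h | h | h
  · exact h.ge
  · exact absurd (Finset.card_lt_card h.1) (not_lt.2 (hmax b hb))
  · exact h.1.1

/-- The marked vertices are distinct: between nested faces the larger one's marked vertex avoids the
smaller one. -/
theorem IsPointedFlag.card_le {c : Finset (Finset V × V)} (hc : IsPointedFlag c) :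
    c.card ≤ (c.sup Prod.fst).card := by
  refine Finset.card_le_card_of_injOn Prod.snd (fun a ha => ?_) fun a ha b hb hab => ?_
  · exact Finset.le_sup (f := Prod.fst) ha (hc.1 a ha)
  · rcases hc.2 a ha b hb with h | h | h
    · exact Prod.ext h hab
    · exact absurd (hab ▸ hc.1 a ha) h.2
    · exact absurd (hab ▸ hc.1 b hb) h.2

variable [Fintype V]

open scoped Classical in
/-- The faces of the antiprism triangulation of a simplex whose carrier is `F`. -/
noncomputable def carried (F : Finset V) : Finset (Finset (Finset V × V)) :=
  {c | IsPointedFlag c ∧ c.sup Prod.fst = F}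

theorem mem_carried {F : Finset V} {c : Finset (Finset V × V)} :
    c ∈ carried F ↔ IsPointedFlag c ∧ c.sup Prod.fst = F := by
  simp [carried]

theorem carried_empty : carried (∅ : Finset V) = {∅} := by
  ext c
  rw [mem_carried, Finset.mem_singleton]
  constructor
  · rintro ⟨hc, h⟩
    have := hc.card_le
    rw [h] at this
    simpa using this
  · rintro rfl
    exact ⟨⟨by simp, by simp⟩, by simp⟩

/-- Split off the pairs whose first entry is `F`: their marked vertices form `S`, and the remaining
pairs have carrier `G`. Adjacency says exactly that `S` avoids `G`, and `S` is nonempty because the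
carrier `F` is attained. -/
theorem sum_carried_eq {M : Type*} [AddCommMonoid M] {F : Finset V} (hF : F.Nonempty)
    (g : ℕ → M) :
    ∑ c ∈ carried F, g c.card = ∑ G ∈ F.ssubsets, ∑ c ∈ carried G,
      ∑ S ∈ (F \ G).powerset.erase ∅, g (c.card + S.card) := by
  simp_rw [Finset.sum_sigma']
  have hsup (c : Finset (Finset V × V)) (hc : c ∈ carried F) (a : Finset V × V) (ha : a ∈ c) :
      a.1 ⊆ F := by
    rw [← (mem_carried.1 hc).2]; exact Finset.le_sup (f := Prod.fst) ha
  have hfst (G : Finset V) (c : Finset (Finset V × V)) (hG : G ⊂ F) (hc : c ∈ carried G)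
      (a : Finset V × V) (ha : a ∈ c) : a.1 ⊂ F := by
    have : a.1 ⊆ G := by
      rw [← (mem_carried.1 hc).2]; exact Finset.le_sup (f := Prod.fst) ha
    exact lt_of_le_of_lt this hG
  refine Finset.sum_bij'
    (fun c _ => ⟨(c.filter fun a => a.1 ≠ F).sup Prod.fst, c.filter fun a => a.1 ≠ F,
      (c.filter fun a => a.1 = F).image Prod.snd⟩)
    (fun x _ => x.2.1 ∪ x.2.2.image (Prod.mk F)) ?_ ?_ ?_ ?_ ?_
  · intro c hc
    obtain ⟨hc1, hc2⟩ := mem_carried.1 hc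
    have hcne : c.Nonempty := by
      rw [Finset.nonempty_iff_ne_empty]
      rintro rfl
      rw [Finset.sup_empty] at hc2
      exact hF.ne_empty hc2.symm
    obtain ⟨a, ha, haF⟩ := hc1.exists_fst_eq_sup hcne
    rw [hc2] at haF
    have hdisj : ∀ b ∈ c, b.1 = F → b.2 ∉ (c.filter fun a => a.1 ≠ F).sup Prod.fst := by
      intro b hb hbF hmem
      rw [Finset.mem_sup] at hmem
      obtain ⟨d, hd, hbd⟩ := hmem
      rw [Finset.mem_filter] at hd
      rcases hc1.2 b hb d hd.1 with h | h | h
      · exact hd.2 (h ▸ hbF)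
      · exact absurd (lt_of_lt_of_le (hbF ▸ h.1) (hsup c hc d hd.1)) (lt_irrefl F)
      · exact h.2 hbd
    have hsub : (c.filter fun a => a.1 ≠ F).sup Prod.fst ⊆ F :=
      Finset.sup_le fun b hb => hsup c hc b (Finset.mem_filter.1 hb).1
    simp only [Finset.mem_sigma, Finset.mem_ssubsets, Finset.mem_erase, Finset.mem_powerset]
    refine ⟨?_, ?_, ?_, ?_⟩
    · refine Finset.ssubset_iff_subset_ne.2 ⟨hsub, fun h => ?_⟩
      refine hdisj a ha haF ?_
      rw [h, ← haF]
      exact hc1.1 a ha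
    · exact mem_carried.2 ⟨hc1.mono (Finset.filter_subset _ _), rfl⟩
    · rw [← Finset.nonempty_iff_ne_empty]
      exact ⟨a.2, Finset.mem_image_of_mem _ (Finset.mem_filter.2 ⟨ha, haF⟩)⟩
    · intro v hv
      obtain ⟨b, hb, rfl⟩ := Finset.mem_image.1 hv
      rw [Finset.mem_filter] at hb
      refine Finset.mem_sdiff.2 ⟨?_, hdisj b hb.1 hb.2⟩
      rw [← hb.2]
      exact hc1.1 b hb.1
  · rintro ⟨G, c, S⟩ hx
    simp only [Finset.mem_sigma, Finset.mem_ssubsets, Finset.mem_erase, Finset.mem_powerset] at hx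
    obtain ⟨hG, hc, hS, hSG⟩ := hx
    have hlt := hfst G c hG hc
    obtain ⟨hc1, hc2⟩ := mem_carried.1 hc
    have hsubG : ∀ a ∈ c, a.1 ⊆ G := fun a ha => by
      rw [← hc2]; exact Finset.le_sup (f := Prod.fst) ha
    have hvG : ∀ v ∈ S, v ∉ G := fun v hv => (Finset.mem_sdiff.1 (hSG hv)).2
    refine mem_carried.2 ⟨⟨?_, ?_⟩, ?_⟩
    · intro a ha
      rcases Finset.mem_union.1 ha with ha | ha
      · exact hc1.1 a ha
      · obtain ⟨v, hv, rfl⟩ := Finset.mem_image.1 ha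
        exact (Finset.mem_sdiff.1 (hSG hv)).1
    · intro a ha b hb
      rcases Finset.mem_union.1 ha with ha | ha <;> rcases Finset.mem_union.1 hb with hb | hb
      · exact hc1.2 a ha b hb
      · obtain ⟨v, hv, rfl⟩ := Finset.mem_image.1 hb
        exact Or.inr (Or.inl ⟨hlt a ha, fun h => hvG v hv (hsubG a ha h)⟩)
      · obtain ⟨v, hv, rfl⟩ := Finset.mem_image.1 ha
        exact Or.inr (Or.inr ⟨hlt b hb, fun h => hvG v hv (hsubG b hb h)⟩)
      · obtain ⟨v, hv, rfl⟩ := Finset.mem_image.1 ha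
        obtain ⟨w, hw, rfl⟩ := Finset.mem_image.1 hb
        exact Or.inl rfl
    · obtain ⟨v, hv⟩ := Finset.nonempty_iff_ne_empty.2 hS
      refine le_antisymm (Finset.sup_le fun a ha => ?_) ?_
      · rcases Finset.mem_union.1 ha with ha | ha
        · exact (hlt a ha).1
        · obtain ⟨v, hv, rfl⟩ := Finset.mem_image.1 ha
          exact le_rfl
      · exact Finset.le_sup (f := Prod.fst) (b := (F, v))
          (Finset.mem_union_right _ (Finset.mem_image_of_mem _ hv))
  · intro c hc
    ext ⟨G, v⟩
    simp only [Finset.mem_union, Finset.mem_filter, Finset.mem_image, Prod.mk.injEq]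
    constructor
    · rintro (h | ⟨w, ⟨⟨H, u⟩, ⟨h1, h2⟩, h3⟩, h4, h5⟩)
      · exact h.1
      · simp only at h2 h3
        subst h2 h3 h4 h5
        exact h1
    · intro h
      by_cases hG : G = F
      · exact Or.inr ⟨v, ⟨(G, v), ⟨h, hG⟩, rfl⟩, hG.symm, rfl⟩
      · exact Or.inl ⟨h, hG⟩
  · rintro ⟨G, c, S⟩ hx
    simp only [Finset.mem_sigma, Finset.mem_ssubsets, Finset.mem_erase, Finset.mem_powerset] at hx
    obtain ⟨hG, hc, hS, hSG⟩ := hx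
    have hlt := hfst G c hG hc
    have e1 : (c ∪ S.image (Prod.mk F)).filter (fun a => a.1 ≠ F) = c := by
      rw [Finset.filter_union, Finset.filter_true_of_mem fun a ha => (hlt a ha).ne,
        Finset.filter_false_of_mem, Finset.union_empty]
      intro a ha
      obtain ⟨v, hv, rfl⟩ := Finset.mem_image.1 ha
      simp
    have e2 : ((c ∪ S.image (Prod.mk F)).filter (fun a => a.1 = F)).image Prod.snd = S := by
      rw [Finset.filter_union, Finset.filter_false_of_mem fun a ha => (hlt a ha).ne,
        Finset.filter_true_of_mem, Finset.empty_union, Finset.image_image]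
      · exact Finset.image_id
      intro a ha
      obtain ⟨v, hv, rfl⟩ := Finset.mem_image.1 ha
      rfl
    simp only [e1, e2, (mem_carried.1 hc).2]
  · intro c hc
    simp only
    rw [Finset.card_image_of_injOn, add_comm, Finset.card_filter_add_card_filter_not]
    intro a ha b hb hab
    simp only [Finset.coe_filter, Set.mem_ofPred_eq] at ha hb
    exact Prod.ext (ha.2.trans hb.2.symm) hab

theorem sum_carried_X_pow (F : Finset V) :
    ∑ c ∈ carried F, X ^ c.card * (1 - X : ℤ[X]) ^ (F.card - c.card) = transPoly F.card 0 := by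
  induction F using Finset.strongInduction with
  | H F ih =>
    rcases F.eq_empty_or_nonempty with rfl | hF
    · simp [carried_empty, transPoly_zero_zero]
    rw [sum_carried_eq hF fun i => X ^ i * (1 - X : ℤ[X]) ^ (F.card - i)]
    have key : ∀ G ∈ F.ssubsets, ∑ c ∈ carried G, ∑ S ∈ (F \ G).powerset.erase ∅,
        X ^ (c.card + S.card) * (1 - X : ℤ[X]) ^ (F.card - (c.card + S.card)) =
        (1 - (1 - X) ^ (F.card - G.card)) * transPoly G.card 0 := by
      intro G hG
      rw [Finset.mem_ssubsets] at hG
      -- Over all subsets the sum is `(X + (1 - X))^(|F| - |G|) = 1`; the subtracted term is that of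
      -- the empty set.
      have h1 : ∑ S ∈ (F \ G).powerset.erase ∅,
          X ^ S.card * (1 - X : ℤ[X]) ^ ((F \ G).card - S.card) =
            1 - (1 - X) ^ (F.card - G.card) := by
        rw [Finset.sum_erase_eq_sub (Finset.empty_mem_powerset _), Finset.sum_pow_mul_eq_add_pow,
          add_sub_cancel, one_pow, Finset.card_sdiff_of_subset hG.1]
        simp
      rw [← ih G hG, ← h1, mul_comm, Finset.sum_mul_sum]
      refine Finset.sum_congr rfl fun c hc => Finset.sum_congr rfl fun S hS => ?_
      have h2 := (mem_carried.1 hc).1.card_le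
      rw [(mem_carried.1 hc).2] at h2
      have h3 := Finset.card_le_card (Finset.mem_powerset.1 (Finset.mem_erase.1 hS).2)
      rw [Finset.card_sdiff_of_subset hG.1] at h3 ⊢
      have h4 := Finset.card_le_card hG.1
      rw [show F.card - (c.card + S.card) = (G.card - c.card) + (F.card - G.card - S.card) by omega]
      ring
    rw [Finset.sum_congr rfl key, transPoly_zero_right hF.card_pos.ne',
      Finset.ssubsets, Finset.sum_erase _ (by simp),
      Finset.sum_powerset_apply_card
        fun m => (1 - (1 - X : ℤ[X]) ^ (F.card - m)) * transPoly m 0]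
    simp only [nsmul_eq_mul]

/-! ### The transformation of h-vectors -/

theorem sum_faceFinset_antiprismTriangulation (Δ : AbstractSimplicialComplex V)
    [Fintype (PointedFace Δ)] (g : ℕ → ℤ[X]) :
    ∑ s ∈ faceFinset (antiprismTriangulation Δ), g s.card =
      ∑ F ∈ faceFinset Δ, ∑ c ∈ carried F, g c.card := by
  have hmem (s : Finset (PointedFace Δ)) : s ∈ faceFinset (antiprismTriangulation Δ) ↔
      IsPointedFlag (s.map (Function.Embedding.subtype _)) := by
    rw [mem_faceFinset, ← isClique_antiprismGraph_iff]
    constructor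
    · rintro (rfl | h)
      · simp
      · exact h.2
    · intro h
      rcases s.eq_empty_or_nonempty with rfl | hs
      · exact Or.inl rfl
      · exact Or.inr ⟨hs, h⟩
  rw [Finset.sum_sigma']
  refine Finset.sum_nbij (fun s => ⟨(s.map (Function.Embedding.subtype _)).sup Prod.fst,
    s.map (Function.Embedding.subtype _)⟩) ?_ ?_ ?_ ?_
  · intro s hs
    rw [hmem] at hs
    rw [Finset.mem_sigma, mem_carried, mem_faceFinset]
    refine ⟨?_, hs, rfl⟩
    rcases s.eq_empty_or_nonempty with rfl | hne
    · simp
    · obtain ⟨a, ha, h⟩ := hs.exists_fst_eq_sup (hne.map (f := Function.Embedding.subtype _))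
      rw [← h]
      obtain ⟨x, -, rfl⟩ := Finset.mem_map.1 ha
      exact Or.inr x.2.1
  · intro s _ t _ h
    simp only [Sigma.mk.injEq] at h
    exact Finset.map_injective _ (eq_of_heq h.2)
  · rintro ⟨F, c⟩ h
    rw [Finset.mem_coe, Finset.mem_sigma, mem_carried, mem_faceFinset] at h
    obtain ⟨hF, hc, h⟩ := h
    dsimp only at hF hc h
    subst h
    have h1 : ∀ a ∈ c, a.1 ∈ Δ ∧ a.2 ∈ a.1 := by
      intro a ha
      have hle : a.1 ⊆ c.sup Prod.fst := Finset.le_sup (f := Prod.fst) ha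
      have ha2 := hc.1 a ha
      refine ⟨?_, ha2⟩
      rcases hF with hF | hF
      · exact absurd (hle ha2) (by simp [hF])
      · exact (Δ.isRelLowerSet_faces hF).2 hle ⟨a.2, ha2⟩
    have : DecidablePred fun x : Finset V × V => x.1 ∈ Δ ∧ x.2 ∈ x.1 := Classical.decPred _
    have h2 : (c.subtype fun x => x.1 ∈ Δ ∧ x.2 ∈ x.1).map (Function.Embedding.subtype _) = c :=
      Finset.subtype_map_of_mem h1
    refine ⟨c.subtype fun x => x.1 ∈ Δ ∧ x.2 ∈ x.1, ?_, ?_⟩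
    · rw [Finset.mem_coe, hmem, h2]
      exact hc
    · simp only [h2]
  · intro s _
    simp

end

theorem rank_antiprismTriangulation {V : Type} [Finite V] (Δ : AbstractSimplicialComplex V) :
    rank (antiprismTriangulation Δ) = rank Δ := by
  classical
  refine rank_eq_of_forall_le ?_ ?_
  · rintro s ⟨hs, hc⟩
    rw [isClique_antiprismGraph_iff] at hc
    have h1 := hc.card_le
    rw [Finset.card_map] at h1
    obtain ⟨a, ha, h⟩ := hc.exists_fst_eq_sup (hs.map (f := Function.Embedding.subtype _))
    rw [← h] at h1
    obtain ⟨x, -, rfl⟩ := Finset.mem_map.1 ha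
    exact h1.trans (card_le_rank x.2.1)
  · intro h
    obtain ⟨F, hF, h⟩ := exists_card_eq_rank h
    -- All pointings of one largest face form a clique of full size.
    refine ⟨F.attach.map ⟨fun v => ⟨(F, v.1), hF, v.2⟩, fun v w hvw => ?_⟩, ⟨?_, ?_⟩, ?_⟩
    · exact Subtype.ext (congrArg (fun x : PointedFace Δ => x.1.2) hvw)
    · rw [Finset.map_nonempty, Finset.attach_nonempty_iff]
      exact (Δ.isRelLowerSet_faces hF).1
    · intro x hx y hy hne
      obtain ⟨v, -, rfl⟩ := Finset.mem_map.1 (Finset.mem_coe.1 hx)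
      obtain ⟨w, -, rfl⟩ := Finset.mem_map.1 (Finset.mem_coe.1 hy)
      exact ⟨hne, Or.inl rfl⟩
    · rw [Finset.card_map, Finset.card_attach, h]

/-- Reindexing by `k = m + r` collects the alternating sums of face numbers that define the
h-vector. -/
theorem sum_faceCount_mul_eq (n : ℕ) {M : Type*} [CommRing M] (f : ℕ → M) (p : ℕ → M) :
    ∑ m ∈ Finset.range (n + 1), f m * ∑ r ∈ Finset.range (n - m + 1),
        (-1) ^ r * ((n - m).choose r : M) * p (m + r) =
      ∑ k ∈ Finset.range (n + 1), (∑ m ∈ Finset.range (k + 1),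
        (-1) ^ (k - m) * ((n - m).choose (k - m) : M) * f m) * p k := by
  simp_rw [Finset.mul_sum, Finset.sum_mul, Finset.sum_sigma']
  refine Finset.sum_bij' (fun x _ => ⟨x.1 + x.2, x.1⟩) (fun x _ => ⟨x.2, x.1 - x.2⟩) ?_ ?_ ?_ ?_ ?_
  · rintro ⟨a, b⟩ h
    simp only [Finset.mem_sigma, Finset.mem_range] at h ⊢
    omega
  · rintro ⟨a, b⟩ h
    simp only [Finset.mem_sigma, Finset.mem_range] at h ⊢
    omega
  · rintro ⟨a, b⟩ h
    simp
  · rintro ⟨a, b⟩ h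
    simp only [Finset.mem_sigma, Finset.mem_range] at h
    simp only [Sigma.mk.injEq, heq_eq_eq, and_true]
    omega
  · rintro ⟨a, b⟩ h
    simp only [Nat.add_sub_cancel_left]
    ring

theorem hVec_antiprismTriangulation {V : Type} [Finite V] (Δ : AbstractSimplicialComplex V)
    {j : ℕ} (hj : j ≤ rank Δ) :
    hVec (antiprismTriangulation Δ) j =
      ∑ k ∈ Finset.range (rank Δ + 1), (transPoly k (rank Δ - k)).coeff j * hVec Δ k := by
  classical
  have := Fintype.ofFinite V
  have := Fintype.ofFinite (PointedFace Δ)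
  rw [hVec_eq_coeff _ (by rwa [rank_antiprismTriangulation]), rank_antiprismTriangulation,
    sum_faceFinset_antiprismTriangulation Δ fun i => X ^ i * (1 - X : ℤ[X]) ^ (rank Δ - i)]
  have h1 : ∀ F ∈ faceFinset Δ, ∑ c ∈ carried F,
      X ^ c.card * (1 - X : ℤ[X]) ^ (rank Δ - c.card) =
        (1 - X) ^ (rank Δ - F.card) * transPoly F.card 0 := by
    intro F hF
    have hle : F.card ≤ rank Δ := by
      rcases mem_faceFinset.1 hF with rfl | hF
      · simp
      · exact card_le_rank hF
    rw [← sum_carried_X_pow, Finset.mul_sum]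
    refine Finset.sum_congr rfl fun c hc => ?_
    have h2 := (mem_carried.1 hc).1.card_le
    rw [(mem_carried.1 hc).2] at h2
    rw [show rank Δ - c.card = (rank Δ - F.card) + (F.card - c.card) by omega]
    ring
  rw [Finset.sum_congr rfl h1,
    sum_faceFinset Δ fun m => (1 - X : ℤ[X]) ^ (rank Δ - m) * transPoly m 0]
  simp_rw [← sum_choose_mul_transPoly]
  have h2 := sum_faceCount_mul_eq (rank Δ) (fun m => (faceCount Δ m : ℤ[X]))
    (fun k => transPoly k (rank Δ - k))
  have h3 : ∀ m ∈ Finset.range (rank Δ + 1), (faceCount Δ m : ℤ[X]) *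
      ∑ r ∈ Finset.range (rank Δ - m + 1), (-1) ^ r * ((rank Δ - m).choose r : ℤ[X]) *
        transPoly (m + r) (0 + (rank Δ - m - r)) = (faceCount Δ m : ℤ[X]) *
      ∑ r ∈ Finset.range (rank Δ - m + 1), (-1) ^ r * ((rank Δ - m).choose r : ℤ[X]) *
        transPoly (m + r) (rank Δ - (m + r)) := by
    intro m _
    simp only [zero_add, Nat.sub_sub]
  rw [Finset.sum_congr rfl h3, h2, finsetSum_coeff]
  refine Finset.sum_congr rfl fun k _ => ?_
  have h4 : ∑ m ∈ Finset.range (k + 1), (-1) ^ (k - m) *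
      ((rank Δ - m).choose (k - m) : ℤ[X]) * (faceCount Δ m : ℤ[X]) = C (hVec Δ k) := by
    simp only [hVec, map_sum, map_mul, map_pow, map_neg, map_one, map_natCast]
  rw [h4, coeff_C_mul, mul_comm]

/-! ### Uniqueness -/

/-- The disjoint union of a simplex with `n` vertices and a simplex with `i` vertices. -/
def twoSimplices (n i : ℕ) : AbstractSimplicialComplex (Fin n ⊕ Fin i) where
  faces := {s | s.Nonempty ∧ (s ⊆ Finset.univ.map .inl ∨ s ⊆ Finset.univ.map .inr)}
  isRelLowerSet_faces := by
    rintro s ⟨hs, h⟩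
    exact ⟨hs, fun t hts ht => ⟨ht, h.imp hts.trans hts.trans⟩⟩
  singleton_mem v := by
    refine ⟨Finset.singleton_nonempty v, ?_⟩
    cases v
    · exact Or.inl (by simp)
    · exact Or.inr (by simp)

theorem rank_twoSimplices {n i : ℕ} (h : i ≤ n) : rank (twoSimplices n i) = n := by
  refine rank_eq_of_forall_le ?_ fun hn => ⟨Finset.univ.map .inl, ⟨?_, Or.inl subset_rfl⟩, by simp⟩
  · rintro F ⟨-, hF | hF⟩
    · simpa using Finset.card_le_card hF
    · exact le_trans (by simpa using Finset.card_le_card hF) h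
  · have : Nonempty (Fin n) := ⟨⟨0, Nat.pos_of_ne_zero hn⟩⟩
    simp

/-- The summand `Nat.choose 0 m` accounts for the empty face shared by the two simplices. -/
theorem faceCount_twoSimplices (n i m : ℕ) :
    faceCount (twoSimplices n i) m + Nat.choose 0 m = n.choose m + i.choose m := by
  have h1 : (faceFinset (twoSimplices n i)).filter (fun F => F.card = m) =
      Finset.powersetCard m (Finset.univ.map .inl) ∪
        Finset.powersetCard m (Finset.univ.map .inr) := by
    ext F
    rw [Finset.mem_filter, mem_faceFinset, Finset.mem_union, Finset.mem_powersetCard,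
      Finset.mem_powersetCard, ← or_and_right]
    refine and_congr_left fun _ => ⟨?_, fun h => ?_⟩
    · rintro (rfl | h)
      · simp
      · exact h.2
    · rcases F.eq_empty_or_nonempty with rfl | hF
      · exact Or.inl rfl
      · exact Or.inr ⟨hF, h⟩
  have h2 : Finset.powersetCard m (Finset.univ.map .inl : Finset (Fin n ⊕ Fin i)) ∩
      Finset.powersetCard m (Finset.univ.map .inr) = Finset.powersetCard m ∅ := by
    have h3 : (Finset.univ.map .inl : Finset (Fin n ⊕ Fin i)) ∩ Finset.univ.map .inr = ∅ := by
      ext x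
      cases x <;> simp
    rw [← h3]
    ext F
    simp only [Finset.mem_inter, Finset.mem_powersetCard, Finset.subset_inter_iff]
    tauto
  have h4 := Finset.card_union_add_card_inter
    (Finset.powersetCard m (Finset.univ.map .inl : Finset (Fin n ⊕ Fin i)))
    (Finset.powersetCard m (Finset.univ.map .inr))
  rw [← h1, h2] at h4
  simpa [faceCount_eq_card, Finset.card_powersetCard] using h4

theorem eq_zero_of_sum_choose_mul_eq_zero {n : ℕ} {e : ℕ → ℤ}
    (h : ∀ i ≤ n, ∑ m ∈ Finset.range (n + 1), (i.choose m : ℤ) * e m = 0) :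
    ∀ i ≤ n, e i = 0 := by
  intro i
  induction i using Nat.strong_induction_on with
  | _ i ih =>
    intro hi
    have := h i hi
    rw [Finset.sum_eq_single i] at this
    · simpa using this
    · intro m hm hmi
      rcases lt_or_gt_of_ne hmi with hlt | hgt
      · rw [ih m hlt (hlt.le.trans hi), mul_zero]
      · rw [Nat.choose_eq_zero_of_lt hgt]; simp
    · intro hi'
      exact absurd (Finset.mem_range.2 (Nat.lt_succ_of_le hi)) hi'

/-- The larger simplex fixes the dimension while the smaller one varies. In terms of face numbers
the relations become a triangular binomial system, and the passage from `d` to `e` is triangular as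
well. -/
theorem eq_zero_of_sum_mul_hVec_eq_zero {n : ℕ} {d : ℕ → ℤ}
    (h : ∀ i ≤ n, ∑ k ∈ Finset.range (n + 1), d k * hVec (twoSimplices n i) k = 0) :
    ∀ k ≤ n, d k = 0 := by
  set e : ℕ → ℤ := fun m => ∑ r ∈ Finset.range (n - m + 1),
    (-1) ^ r * ((n - m).choose r : ℤ) * d (m + r) with he
  have h1 : ∀ i ≤ n, ∑ m ∈ Finset.range (n + 1), (faceCount (twoSimplices n i) m : ℤ) * e m = 0 := by
    intro i hi
    rw [← h i hi, he, sum_faceCount_mul_eq n (fun m => (faceCount (twoSimplices n i) m : ℤ)) d]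
    refine Finset.sum_congr rfl fun k _ => ?_
    rw [hVec, rank_twoSimplices hi, mul_comm]
  set E : ℕ → ℤ := fun i => ∑ m ∈ Finset.range (n + 1), (i.choose m : ℤ) * e m with hE
  have h2 : ∀ i ≤ n, E n + E i = E 0 := by
    intro i hi
    rw [← zero_add (E 0), ← h1 i hi]
    simp only [hE, ← Finset.sum_add_distrib, ← add_mul]
    refine Finset.sum_congr rfl fun m _ => ?_
    rw [← Nat.cast_add, ← Nat.cast_add, faceCount_twoSimplices]
  -- The case `i = 0` gives `E n = 0`, then `i = n` gives `E 0 = 0`, and the rest follows.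
  have h3 : ∀ i ≤ n, E i = 0 := by
    intro i hi
    have := h2 0 (Nat.zero_le _)
    have := h2 n le_rfl
    have := h2 i hi
    linarith
  have h4 := eq_zero_of_sum_choose_mul_eq_zero h3
  -- Downward induction on `k`: `e k` is `d k` plus a combination of later entries.
  have h5 : ∀ t k, k + t = n → d k = 0 := by
    intro t
    induction t using Nat.strong_induction_on with
    | _ t ih =>
      intro k hk
      have h6 := h4 k (by omega)
      rw [he] at h6
      dsimp only at h6
      rw [Finset.sum_eq_single 0] at h6
      · simpa using h6
      · intro r hr hr0
        rw [Finset.mem_range] at hr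
        rw [ih (t - r) (by omega) (k + r) (by omega), mul_zero]
      · simp
  exact fun k hk => h5 (n - k) k (by omega)

end Antiprism

theorem mainTheorem12 :
    ∃ p : ℕ → ℕ → ℕ → ℕ,
      -- `p` is the array of coefficients of the transformation of `h`-vectors,
      Antiprism.IsAntiprismTransformation (fun n k j => (p n k j : ℤ)) ∧
      -- which determines `p n k j` for `k, j ≤ n`
      (∀ p' : ℕ → ℕ → ℕ → ℤ, Antiprism.IsAntiprismTransformation p' →
        ∀ n k j : ℕ, k ≤ n → j ≤ n → p' n k j = (p n k j : ℤ)) ∧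
      (∀ n k j : ℕ, k ≤ n → j ≤ n → p n k j = p n (n - k) (n - j)) ∧
      (∀ n k : ℕ, k ≤ n →
        (∀ j : ℕ, j + 1 ≤ n / 2 → p n k j ≤ p n k (j + 1)) ∧
        (∀ j : ℕ, (n + 1) / 2 ≤ j → j + 1 ≤ n → p n k (j + 1) ≤ p n k j)) := by
  open Antiprism in
  have hcast (n k j : ℕ) : (((transPoly k (n - k)).coeff j).toNat : ℤ) =
      (transPoly k (n - k)).coeff j :=
    Int.toNat_of_nonneg ((transPoly_mem_peaked k (n - k)).1 j)
  have htrans : IsAntiprismTransformation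
      (fun n k j => (((transPoly k (n - k)).coeff j).toNat : ℤ)) := by
    rintro V _ Δ n rfl j hj
    simp only [hcast]
    exact hVec_antiprismTriangulation Δ hj
  refine ⟨fun n k j => ((transPoly k (n - k)).coeff j).toNat, htrans, ?_, ?_, ?_⟩
  · intro p' hp' n k j hk hj
    rw [← sub_eq_zero]
    refine eq_zero_of_sum_mul_hVec_eq_zero (n := n)
      (d := fun k => p' n k j - (((transPoly k (n - k)).coeff j).toNat : ℤ)) (fun i hi => ?_) k hk
    have h1 := hp' _ (twoSimplices n i) n (rank_twoSimplices hi) j hj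
    have h2 := htrans _ (twoSimplices n i) n (rank_twoSimplices hi) j hj
    simp only [sub_mul, Finset.sum_sub_distrib]
    rw [← h1, ← h2, sub_self]
  · intro n k j hk hj
    dsimp only
    rw [coeff_transPoly_symm (by omega), Nat.sub_sub_self hk, Nat.add_sub_cancel' hk]
  · intro n k hk
    have h := transPoly_mem_peaked k (n - k)
    rw [Nat.add_sub_cancel' hk] at h
    exact ⟨fun j hj => Int.toNat_le_toNat (h.2.1 j hj),
      fun j hj _ => Int.toNat_le_toNat (h.2.2 j hj)⟩
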